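/- **Theorem.** Let $\kappa\in(0,1)$ and $\lambda=\sqrt{1-\kappa^2}$. Let $f(T)=\int_0^T {}_2F_1(\tfrac14,\tfrac34;\tfrac12;\kappa^2\sin^2 t)\,dt$ for complex $T$ near $0$, let $\phi$ be the analytic local inverse of $f$ near $0$ with $\phi(0)=0$, and let $\psi$ be the analytic function near $0$ with $\psi(0)=0$ and $\sin\psi=\kappa\sin\phi$. Then $\cos\psi$ extends uniquely to a meromorphic function $d_\kappa$ on $\mathbb{C}$. This function is elliptic, and it has fundamental periods $2K_\kappa$ and $2iK'_\kappa$ (that is, an $\mathbb{R}$-linearly independent pair whose integral combinations are exactly the periods of $d_\kappa$) for exactly one pair of real numbers $K_\kappa>0$, $K'_\kappa>0$, namely $$K_\kappa=\sqrt{\frac{2}{1+\lambda}}\;K\Big(\frac{1-\lambda}{1+\lambda}\Big)\qquad\text{and}\qquad K'_\kappa=\sqrt{\frac{2}{1+\lambda}}\;K\Big(\frac{2\lambda}{1+\lambda}\Big),$$ where $K(k^2)=\int_0^{\pi/2}\frac{d\theta}{\sqrt{1-k^2\sin^2\theta}}$ for $0<k<1$ is the complete elliptic integral of the first kind, taken as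 a function of $k^2$. -/

import Mathlib

open Filter Topology

noncomputable section

namespace SignatureFour

/-- The function `f(T) = ∫₀ᵀ F(1/4, 3/4; 1/2; κ² sin² t) dt` of a complex variable `T`, the integral
being taken along the segment `t = s T`, `0 ≤ s ≤ 1`. Only its germ at `0` is used. -/
def incompleteIntegral (κ : ℝ) (T : ℂ) : ℂ :=
  T * ∫ s in (0 : ℝ)..1,
    ordinaryHypergeometric (1 / 4 : ℂ) (3 / 4 : ℂ) (1 / 2 : ℂ)
      ((κ : ℂ) ^ 2 * Complex.sin ((s : ℂ) * T) ^ 2)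

/-- `φ` is (the germ at `0` of) the analytic local inverse of `f` with `φ 0 = 0`. -/
structure IsLocalAmplitude (κ : ℝ) (φ : ℂ → ℂ) : Prop where
  analyticAt : AnalyticAt ℂ φ 0
  map_zero : φ 0 = 0
  right_inv : ∀ᶠ u in 𝓝 (0 : ℂ), incompleteIntegral κ (φ u) = u
  left_inv : ∀ᶠ t in 𝓝 (0 : ℂ), φ (incompleteIntegral κ t) = t

/-- `ψ` is (the germ at `0` of) the analytic function with `ψ 0 = 0` and `sin ψ = κ sin φ`. -/
structure IsAuxiliaryAngle (κ : ℝ) (φ ψ : ℂ → ℂ) : Prop where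
  analyticAt : AnalyticAt ℂ ψ 0
  map_zero : ψ 0 = 0
  sin_eq : ∀ᶠ u in 𝓝 (0 : ℂ), Complex.sin (ψ u) = (κ : ℂ) * Complex.sin (φ u)

/-- `d` is the function `dn₂` of modulus `κ`: the meromorphic function on the whole plane that is
given near `0` by `d = cos ψ`. Normal form means that `d` takes the value `0` at each of its poles
and its limiting value at every other point, so `d` is determined as a function `ℂ → ℂ`.
Double periodicity is not part of the definition. -/
structure IsDn (κ : ℝ) (d : ℂ → ℂ) : Prop where
  meromorphic : MeromorphicNFOn d Set.univ
  eq_cos : ∃ φ ψ : ℂ → ℂ, IsLocalAmplitude κ φ ∧ IsAuxiliaryAngle κ φ ψ ∧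
    ∀ᶠ u in 𝓝 (0 : ℂ), d u = Complex.cos (ψ u)

/-- `w₁` and `w₂` are fundamental periods of `d`: they are linearly independent over `ℝ`, and the
periods of `d` are exactly the integral combinations of `w₁` and `w₂`. -/
def IsFundamentalPeriods (d : ℂ → ℂ) (w₁ w₂ : ℂ) : Prop :=
  LinearIndependent ℝ ![w₁, w₂] ∧
    ∀ w : ℂ, Function.Periodic d w ↔ ∃ m n : ℤ, w = (m : ℂ) * w₁ + (n : ℂ) * w₂

/-- The complete elliptic integral of the first kind as a function of the parameter `m = k²`. -/
def ellipticK (m : ℝ) : ℝ :=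
  ∫ θ in (0 : ℝ)..(Real.pi / 2), 1 / √(1 - m * Real.sin θ ^ 2)

end SignatureFour

end

/-!
The hypergeometric function is elementary here: summing binomial series gives
`F(1/4, 3/4; 1/2; w²) = ((1 - w) ^ (-1/2) + (1 + w) ^ (-1/2)) / 2`, hence
`F(1/4, 3/4; 1/2; sin² p) = cos (p / 2) / cos p`. Differentiating `f (φ u) = u` and
`sin ψ = κ sin φ` therefore shows that `σ = sin (ψ / 2)` satisfies `σ' = (κ / 2) cos φ` and
`σ'' = -σ + 2 σ³`. The function `b sn (a u | m)` with `m = (1 - λ) / (1 + λ)`,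
`a² = (1 + λ) / 2` and `b² = (1 - λ) / 2` solves the same initial value problem, so
`cos ψ = 1 - 2 b² sn² (a u | m)`.

Jacobi's imaginary transformation continues the real function `sn` meromorphically to the plane.
At a period of `sn²` the function `sn` vanishes, and the zeros of `sn` are exactly the points of
the lattice generated by `2 K(m)` and `2 i K(1 - m)`; dividing by `a` gives the period lattice of
`cos ψ`.
-/

noncomputable section

namespace SignatureFour

/-! ### Hypergeometric functions -/

section Pochhammer

variable {k : Type*} [Field k] [CharZero k]

lemma ascPochhammer_eval_two_mul (a : k) (n : ℕ) :
    (ascPochhammer k (2 * n)).eval (2 * a) =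
      4 ^ n * (ascPochhammer k n).eval a * (ascPochhammer k n).eval (a + 1 / 2) := by
  induction n with
  | zero => simp
  | succ n ih =>
    rw [show 2 * (n + 1) = 2 * n + 1 + 1 from rfl]
    simp only [ascPochhammer_succ_eval, ih]
    push_cast
    field

lemma cast_factorial_two_mul (n : ℕ) :
    ((2 * n).factorial : k) = 4 ^ n * (ascPochhammer k n).eval (1 / 2) * n.factorial := by
  have h := ascPochhammer_eval_two_mul (1 / 2 : k) n
  rwa [add_halves, mul_one_div_cancel two_ne_zero, ascPochhammer_eval_one,
    ascPochhammer_eval_one] at h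

lemma choose_eq_ordinaryHypergeometricCoefficient (a : k) (n : ℕ) :
    Ring.choose (2 * a + (2 * n : ℕ) - 1) (2 * n) =
      ordinaryHypergeometricCoefficient a (a + 1 / 2) (1 / 2) n := by
  have hfac := cast_factorial_two_mul (k := k) n
  have hne : 4 ^ n * (ascPochhammer k n).eval (1 / 2) * (n.factorial : k) ≠ 0 :=
    hfac ▸ Nat.cast_ne_zero.mpr (2 * n).factorial_ne_zero
  have h4 : (4 : k) ^ n ≠ 0 := left_ne_zero_of_mul (left_ne_zero_of_mul hne)
  have hchoose := Ring.factorial_nsmul_multichoose_eq_ascPochhammer (2 * a) (2 * n)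
  rw [Polynomial.ascPochhammer_smeval_cast, Polynomial.ascPochhammer_smeval_eq_eval, nsmul_eq_mul,
    Ring.multichoose_eq, ascPochhammer_eval_two_mul, hfac] at hchoose
  rw [eq_div_of_mul_eq hne ((mul_comm _ _).trans hchoose), ordinaryHypergeometricCoefficient,
    mul_assoc, mul_assoc, mul_div_mul_left _ _ h4]
  ring

end Pochhammer

lemma hasSum_choose_mul_pow (a : ℂ) {w : ℂ} (hw : ‖w‖ < 1) :
    HasSum (fun n : ℕ ↦ Ring.choose (a + n - 1) n * w ^ n) (1 / (1 - w) ^ a) := by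
  have h := (Complex.one_div_one_sub_cpow_hasFPowerSeriesOnBall_zero a).hasSum (y := w)
    (by simpa [← ENNReal.ofReal_one, Metric.eball_ofReal] using hw)
  simpa [FormalMultilinearSeries.ofScalars_apply_eq, mul_comm] using h

lemma ordinaryHypergeometric_add_half_sq (a : ℂ) {w : ℂ} (hw : ‖w‖ < 1) :
    ordinaryHypergeometric a (a + 1 / 2) (1 / 2) (w ^ 2) =
      (1 / (1 - w) ^ (2 * a) + 1 / (1 + w) ^ (2 * a)) / 2 := by
  have hsum := ((hasSum_choose_mul_pow (2 * a) hw).add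
    (hasSum_choose_mul_pow (2 * a) (w := -w) (by rwa [norm_neg]))).div_const 2
  have hinj : Function.Injective fun n : ℕ ↦ 2 * n := mul_right_injective₀ two_ne_zero
  rw [sub_neg_eq_add, ← hinj.hasSum_iff fun n hn ↦ ?odd] at hsum
  case odd =>
    have hodd : Odd n := Nat.not_even_iff_odd.mp fun heven ↦
      hn ⟨n / 2, Nat.two_mul_div_two_of_even heven⟩
    rw [hodd.neg_pow]
    ring
  rw [ordinaryHypergeometric, ordinaryHypergeometric_sum_eq, ← hsum.tsum_eq]
  refine tsum_congr fun n ↦ ?_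
  rw [Function.comp_apply, choose_eq_ordinaryHypergeometricCoefficient, (even_two_mul n).neg_pow,
    pow_mul, smul_eq_mul]
  ring

lemma eventually_hypergeometric_sin_sq :
    ∀ᶠ p in 𝓝 (0 : ℂ), ordinaryHypergeometric (1 / 4 : ℂ) (3 / 4 : ℂ) (1 / 2 : ℂ)
      (Complex.sin p ^ 2) = Complex.cos (p / 2) / Complex.cos p := by
  have hnorm : ∀ᶠ p in 𝓝 (0 : ℂ), ‖Complex.sin p‖ < 1 :=
    (by fun_prop : ContinuousAt (fun p ↦ ‖Complex.sin p‖) 0).eventually_lt_const (by simp)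
  have hsub : ∀ᶠ p in 𝓝 (0 : ℂ), 0 < (Complex.cos (p / 2) - Complex.sin (p / 2)).re :=
    (by fun_prop : ContinuousAt (fun p : ℂ ↦
      (Complex.cos (p / 2) - Complex.sin (p / 2)).re) 0).eventually_const_lt (by simp)
  have hadd : ∀ᶠ p in 𝓝 (0 : ℂ), 0 < (Complex.cos (p / 2) + Complex.sin (p / 2)).re :=
    (by fun_prop : ContinuousAt (fun p : ℂ ↦
      (Complex.cos (p / 2) + Complex.sin (p / 2)).re) 0).eventually_const_lt (by simp)
  filter_upwards [hnorm, hsub, hadd] with p hp hpos_sub hpos_add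
  have hne_sub := Complex.ne_zero_of_re_pos hpos_sub
  have hne_add := Complex.ne_zero_of_re_pos hpos_add
  obtain ⟨q, rfl⟩ : ∃ q, p = 2 * q := ⟨p / 2, by ring⟩
  rw [mul_div_cancel_left₀ q two_ne_zero] at *
  have hunit := Complex.sin_sq_add_cos_sq q
  have hF := ordinaryHypergeometric_add_half_sq (1 / 4) hp
  rw [show (1 / 4 + 1 / 2 : ℂ) = 3 / 4 by norm_num, show (2 * (1 / 4) : ℂ) = 2⁻¹ by norm_num] at hF
  rw [hF, Complex.cos_two_mul', Complex.sin_two_mul,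
    show 1 - 2 * Complex.sin q * Complex.cos q = (Complex.cos q - Complex.sin q) ^ 2 by
      linear_combination -hunit,
    show 1 + 2 * Complex.sin q * Complex.cos q = (Complex.cos q + Complex.sin q) ^ 2 by
      linear_combination -hunit,
    Complex.sq_cpow_two_inv hpos_sub, Complex.sq_cpow_two_inv hpos_add, sq_sub_sq]
  field

lemma ordinaryHypergeometricSeries_radius_pos {𝕜 : Type*} [RCLike 𝕜] (a b c : 𝕜) :
    0 < (ordinaryHypergeometricSeries 𝕜 a b c).radius := by
  by_cases h : ∀ n : ℕ, a ≠ -n ∧ b ≠ -n ∧ c ≠ -n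
  · rw [ordinaryHypergeometricSeries_radius_eq_one 𝕜 a b c fun n ↦ by
      simpa only [ne_eq, eq_neg_iff_add_eq_zero, add_comm] using h n]
    exact one_pos
  · simp only [not_forall, not_and_or, not_not] at h
    obtain ⟨n, rfl | rfl | rfl⟩ := h
    · simp [ordinaryHypergeometric_radius_top_of_neg_nat₁]
    · simp [ordinaryHypergeometric_radius_top_of_neg_nat₂]
    · simp [ordinaryHypergeometric_radius_top_of_neg_nat₃]

lemma analyticAt_ordinaryHypergeometric_zero {𝕜 : Type*} [RCLike 𝕜] (a b c : 𝕜) :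
    AnalyticAt 𝕜 (ordinaryHypergeometric a b c : 𝕜 → 𝕜) 0 :=
  ((ordinaryHypergeometricSeries 𝕜 a b c).hasFPowerSeriesOnBall
    (ordinaryHypergeometricSeries_radius_pos a b c)).analyticAt

/-! ### The amplitude and the auxiliary angle -/

lemma hasDerivAt_smul_segment_integral {E : Type*} [NormedAddCommGroup E] [NormedSpace ℂ E]
    [CompleteSpace E] {G : ℂ → E} {c : ℂ} {r : ℝ} (hG : DifferentiableOn ℂ G (Metric.ball c r))
    {z : ℂ} (hz : z ∈ Metric.ball c r) :
    HasDerivAt (fun z ↦ (z - c) • ∫ s in (0 : ℝ)..1, G (c + s • (z - c))) (G z) z := by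
  obtain ⟨P, hPc, hP⟩ := hG.isExactOn_ball.with_val_at c 0
  refine (hP z hz).congr_of_eventuallyEq ?_
  filter_upwards [Metric.isOpen_ball.mem_nhds hz] with w hw
  have hseg : ∀ s ∈ Set.Icc (0 : ℝ) 1, c + s • (w - c) ∈ Metric.ball c r := fun s hs ↦
    (convex_ball c r).add_smul_sub_mem (Metric.mem_ball_self (Metric.pos_of_mem_ball hw)) hw hs
  rw [intervalIntegral.integral_unitInterval_deriv_eq_sub
    (hG.continuousOn.comp (by fun_prop) hseg) fun s hs ↦ hP _ (hseg s hs), hPc, sub_zero,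
    add_sub_cancel]

lemma eventually_hasDerivAt_incompleteIntegral (κ : ℝ) :
    ∀ᶠ T in 𝓝 (0 : ℂ), HasDerivAt (incompleteIntegral κ)
      (ordinaryHypergeometric (1 / 4 : ℂ) (3 / 4 : ℂ) (1 / 2 : ℂ)
        ((κ : ℂ) ^ 2 * Complex.sin T ^ 2)) T := by
  have hG : AnalyticAt ℂ (fun T : ℂ ↦ ordinaryHypergeometric (1 / 4 : ℂ) (3 / 4 : ℂ) (1 / 2 : ℂ)
      ((κ : ℂ) ^ 2 * Complex.sin T ^ 2)) 0 :=
    AnalyticAt.fun_comp (by simpa using analyticAt_ordinaryHypergeometric_zero _ _ _) (by fun_prop)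
  obtain ⟨r, hr, hball⟩ := Metric.eventually_nhds_iff_ball.mp
    (Complex.analyticAt_iff_eventually_differentiableAt.mp hG)
  filter_upwards [Metric.ball_mem_nhds 0 hr] with T hT
  have h := hasDerivAt_smul_segment_integral (fun z hz ↦ (hball z hz).differentiableWithinAt) hT
  simp only [sub_zero, zero_add, Complex.real_smul] at h
  exact h

lemma analyticAt_incompleteIntegral (κ : ℝ) : AnalyticAt ℂ (incompleteIntegral κ) 0 :=
  Complex.analyticAt_iff_eventually_differentiableAt.mpr
    ((eventually_hasDerivAt_incompleteIntegral κ).mono fun _ h ↦ h.differentiableAt)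

lemma incompleteIntegral_zero (κ : ℝ) : incompleteIntegral κ 0 = 0 :=
  zero_mul _

lemma deriv_incompleteIntegral_zero (κ : ℝ) : deriv (incompleteIntegral κ) 0 = 1 := by
  rw [(eventually_hasDerivAt_incompleteIntegral κ).self_of_nhds.deriv]
  simp [ordinaryHypergeometric_zero]

lemma exists_analyticAt_local_inverse {𝕜 : Type*} [NontriviallyNormedField 𝕜] [CompleteSpace 𝕜]
    [CharZero 𝕜] {f : 𝕜 → 𝕜} {x : 𝕜} (hf : AnalyticAt 𝕜 f x) (hf' : deriv f x ≠ 0) :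
    ∃ g : 𝕜 → 𝕜, AnalyticAt 𝕜 g (f x) ∧ g (f x) = x ∧ (∀ᶠ y in 𝓝 (f x), f (g y) = y) ∧
      ∀ᶠ z in 𝓝 x, g (f z) = z :=
  have hs := hf.hasStrictDerivAt
  have hleft := hs.eventually_left_inverse hf'
  ⟨hs.localInverse f _ x hf', hf.analyticAt_localInverse hf', hleft.self_of_nhds,
    hs.eventually_right_inverse hf', hleft⟩

lemma exists_isLocalAmplitude (κ : ℝ) : ∃ φ, IsLocalAmplitude κ φ := by
  obtain ⟨φ, hφ, hφ₀, hright, hleft⟩ := exists_analyticAt_local_inverse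
    (analyticAt_incompleteIntegral κ) (by simp [deriv_incompleteIntegral_zero])
  rw [incompleteIntegral_zero] at hφ hφ₀ hright
  exact ⟨φ, hφ, hφ₀, hright, hleft⟩

variable {κ : ℝ} {φ ψ : ℂ → ℂ}

lemma IsLocalAmplitude.tendsto (hφ : IsLocalAmplitude κ φ) : Tendsto φ (𝓝 0) (𝓝 0) := by
  simpa [hφ.map_zero] using hφ.analyticAt.continuousAt.tendsto

lemma IsAuxiliaryAngle.tendsto (hψ : IsAuxiliaryAngle κ φ ψ) : Tendsto ψ (𝓝 0) (𝓝 0) := by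
  simpa [hψ.map_zero] using hψ.analyticAt.continuousAt.tendsto

lemma IsLocalAmplitude.exists_isAuxiliaryAngle (hφ : IsLocalAmplitude κ φ) :
    ∃ ψ, IsAuxiliaryAngle κ φ ψ := by
  obtain ⟨arcsin, han, h₀, hright, -⟩ := exists_analyticAt_local_inverse (f := Complex.sin) (x := 0)
    (by fun_prop) (by simp)
  rw [Complex.sin_zero] at han h₀ hright
  have hsin : AnalyticAt ℂ (fun u ↦ κ * Complex.sin (φ u)) 0 := by
    have := hφ.analyticAt
    fun_prop
  have hsin₀ : κ * Complex.sin (φ 0) = 0 := by simp [hφ.map_zero]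
  have htendsto : Tendsto (fun u ↦ κ * Complex.sin (φ u)) (𝓝 0) (𝓝 0) := by
    simpa only [hsin₀] using hsin.continuousAt.tendsto
  exact ⟨fun u ↦ arcsin (κ * Complex.sin (φ u)), AnalyticAt.fun_comp (by rwa [hsin₀]) hsin,
    by rw [hsin₀, h₀], htendsto.eventually hright⟩

lemma IsAuxiliaryAngle.cos_half_mul_deriv_amplitude (hψ : IsAuxiliaryAngle κ φ ψ)
    (hφ : IsLocalAmplitude κ φ) :
    ∀ᶠ u in 𝓝 (0 : ℂ), Complex.cos (ψ u / 2) * deriv φ u = Complex.cos (ψ u) := by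
  have hcos : ∀ᶠ p in 𝓝 (0 : ℂ), Complex.cos p ≠ 0 :=
    Complex.continuous_cos.continuousAt.eventually_ne (by simp)
  filter_upwards [hφ.tendsto.eventually (eventually_hasDerivAt_incompleteIntegral κ),
    hφ.right_inv.eventually_nhds, hψ.sin_eq, hψ.tendsto.eventually eventually_hypergeometric_sin_sq,
    hψ.tendsto.eventually hcos, hφ.analyticAt.eventually_analyticAt]
    with u hf hinv hsin hF hcos hφu
  rw [← mul_pow, ← hsin, hF] at hf
  have hchain : Complex.cos (ψ u / 2) / Complex.cos (ψ u) * deriv φ u = 1 :=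
    ((hf.comp u hφu.differentiableAt.hasDerivAt).congr_of_eventuallyEq
      (hinv.mono fun _ h ↦ h.symm)).unique (hasDerivAt_id u)
  rwa [div_mul_eq_mul_div, div_eq_one_iff_eq hcos] at hchain

lemma IsAuxiliaryAngle.cos_half_mul_deriv (hψ : IsAuxiliaryAngle κ φ ψ)
    (hφ : IsLocalAmplitude κ φ) :
    ∀ᶠ u in 𝓝 (0 : ℂ), Complex.cos (ψ u / 2) * deriv ψ u = κ * Complex.cos (φ u) := by
  have hcos : ∀ᶠ p in 𝓝 (0 : ℂ), Complex.cos p ≠ 0 :=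
    Complex.continuous_cos.continuousAt.eventually_ne (by simp)
  filter_upwards [hψ.cos_half_mul_deriv_amplitude hφ, hψ.sin_eq.eventually_nhds,
    hψ.tendsto.eventually hcos, hφ.analyticAt.eventually_analyticAt,
    hψ.analyticAt.eventually_analyticAt] with u hφ' hsin hcos hφu hψu
  have hchain : Complex.cos (ψ u) * deriv ψ u = κ * (Complex.cos (φ u) * deriv φ u) :=
    (hψu.differentiableAt.hasDerivAt.csin.congr_of_eventuallyEq
      (hsin.mono fun _ h ↦ h.symm)).unique (hφu.differentiableAt.hasDerivAt.csin.const_mul (κ : ℂ))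
  apply mul_left_cancel₀ hcos
  linear_combination Complex.cos (ψ u / 2) * hchain + κ * Complex.cos (φ u) * hφ'

lemma IsAuxiliaryAngle.hasDerivAt_sin_half (hψ : IsAuxiliaryAngle κ φ ψ)
    (hφ : IsLocalAmplitude κ φ) :
    ∀ᶠ u in 𝓝 (0 : ℂ),
      HasDerivAt (fun u ↦ Complex.sin (ψ u / 2)) (κ / 2 * Complex.cos (φ u)) u := by
  filter_upwards [hψ.cos_half_mul_deriv hφ, hψ.analyticAt.eventually_analyticAt] with u hψ' hψu
  refine (hψu.differentiableAt.hasDerivAt.div_const 2).csin.congr_deriv ?_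
  linear_combination hψ' / 2

lemma IsAuxiliaryAngle.hasDerivAt_cos_amplitude (hψ : IsAuxiliaryAngle κ φ ψ)
    (hφ : IsLocalAmplitude κ φ) :
    ∀ᶠ u in 𝓝 (0 : ℂ), HasDerivAt (fun u ↦ κ / 2 * Complex.cos (φ u))
      (-Complex.sin (ψ u / 2) + 2 * Complex.sin (ψ u / 2) ^ 3) u := by
  have hcos_half : ∀ᶠ p in 𝓝 (0 : ℂ), Complex.cos (p / 2) ≠ 0 :=
    (by fun_prop : ContinuousAt (fun p : ℂ ↦ Complex.cos (p / 2)) 0).eventually_ne (by simp)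
  filter_upwards [hψ.cos_half_mul_deriv_amplitude hφ, hψ.sin_eq, hψ.tendsto.eventually hcos_half,
    hφ.analyticAt.eventually_analyticAt] with u hφ' hsin hcos_half hφu
  refine (hφu.differentiableAt.hasDerivAt.ccos.const_mul ((κ : ℂ) / 2)).congr_deriv ?_
  have hsin_two := Complex.sin_two_mul (ψ u / 2)
  have hcos_two := Complex.cos_two_mul_eq_one_sub (ψ u / 2)
  rw [mul_div_cancel₀ _ two_ne_zero] at hsin_two hcos_two
  apply mul_left_cancel₀ hcos_half
  linear_combination (-(κ : ℂ) / 2 * Complex.sin (φ u)) * hφ' +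
    Complex.cos (ψ u) / 2 * (hsin - hsin_two) -
    Complex.sin (ψ u / 2) * Complex.cos (ψ u / 2) * hcos_two

/-! ### Real Jacobi elliptic functions -/

/-- The incomplete elliptic integral of the first kind with parameter `m`. -/
def ellipticF (m θ : ℝ) : ℝ := ∫ t in (0 : ℝ)..θ, 1 / √(1 - m * Real.sin t ^ 2)

/-- The Jacobi amplitude with parameter `m`, the inverse function of `ellipticF m`. -/
def jacobiAm (m : ℝ) : ℝ → ℝ := Function.invFun (ellipticF m)

/-- The Jacobi elliptic function `sn` of a real variable with parameter `m`. -/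
def jacobiSn (m x : ℝ) : ℝ := Real.sin (jacobiAm m x)

/-- The Jacobi elliptic function `cn` of a real variable with parameter `m`. -/
def jacobiCn (m x : ℝ) : ℝ := Real.cos (jacobiAm m x)

/-- The Jacobi elliptic function `dn` of a real variable with parameter `m`. -/
def jacobiDn (m x : ℝ) : ℝ := √(1 - m * jacobiSn m x ^ 2)

section Real

variable {m : ℝ}

lemma periodic_ellipticF_integrand (m : ℝ) :
    Function.Periodic (fun t ↦ 1 / √(1 - m * Real.sin t ^ 2)) Real.pi := fun t ↦ by
  simp only [Real.sin_add_pi, neg_sq]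

lemma ellipticF_zero (m : ℝ) : ellipticF m 0 = 0 :=
  intervalIntegral.integral_same

lemma jacobiCn_sq (m x : ℝ) : jacobiCn m x ^ 2 = 1 - jacobiSn m x ^ 2 :=
  Real.cos_sq' _

variable (hm : m < 1)
include hm

lemma one_sub_mul_sin_sq_pos (θ : ℝ) : 0 < 1 - m * Real.sin θ ^ 2 := by
  rcases le_total 0 m with h | h <;> nlinarith [Real.sin_sq_le_one θ, sq_nonneg (Real.sin θ)]

lemma ellipticF_integrand_pos (θ : ℝ) : 0 < 1 / √(1 - m * Real.sin θ ^ 2) :=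
  one_div_pos.mpr (Real.sqrt_pos.mpr (one_sub_mul_sin_sq_pos hm θ))

lemma continuous_ellipticF_integrand : Continuous fun t ↦ 1 / √(1 - m * Real.sin t ^ 2) :=
  Continuous.div (by fun_prop) (by fun_prop)
    fun t ↦ (Real.sqrt_pos.mpr (one_sub_mul_sin_sq_pos hm t)).ne'

lemma intervalIntegrable_ellipticF_integrand (a b : ℝ) :
    IntervalIntegrable (fun t ↦ 1 / √(1 - m * Real.sin t ^ 2)) MeasureTheory.volume a b :=
  (continuous_ellipticF_integrand hm).intervalIntegrable a b

lemma hasDerivAt_ellipticF (θ : ℝ) :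
    HasDerivAt (ellipticF m) (1 / √(1 - m * Real.sin θ ^ 2)) θ :=
  ((continuous_ellipticF_integrand hm).integral_hasStrictDerivAt 0 θ).hasDerivAt

lemma strictMono_ellipticF : StrictMono (ellipticF m) :=
  strictMono_of_hasDerivAt_pos (hasDerivAt_ellipticF hm) (ellipticF_integrand_pos hm)

lemma surjective_ellipticF : Function.Surjective (ellipticF m) :=
  Continuous.surjective
    (continuous_iff_continuousAt.mpr fun θ ↦ (hasDerivAt_ellipticF hm θ).continuousAt)
    ((periodic_ellipticF_integrand m).tendsto_atTop_intervalIntegral_of_pos'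
      (intervalIntegrable_ellipticF_integrand hm _ _) (ellipticF_integrand_pos hm) Real.pi_pos)
    ((periodic_ellipticF_integrand m).tendsto_atBot_intervalIntegral_of_pos'
      (intervalIntegrable_ellipticF_integrand hm _ _) (ellipticF_integrand_pos hm) Real.pi_pos)

lemma ellipticK_pos : 0 < ellipticK m :=
  intervalIntegral.intervalIntegral_pos_of_pos (intervalIntegrable_ellipticF_integrand hm _ _)
    (ellipticF_integrand_pos hm) Real.pi_div_two_pos

lemma ellipticF_pi : ellipticF m Real.pi = 2 * ellipticK m := by
  have hreflect := intervalIntegral.integral_comp_sub_left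
    (fun t ↦ 1 / √(1 - m * Real.sin t ^ 2)) Real.pi (a := 0) (b := Real.pi / 2)
  simp only [Real.sin_pi_sub, sub_zero, sub_half] at hreflect
  rw [ellipticF, ← intervalIntegral.integral_add_adjacent_intervals
    (intervalIntegrable_ellipticF_integrand hm 0 (Real.pi / 2))
    (intervalIntegrable_ellipticF_integrand hm _ _), ← hreflect, ellipticK, two_mul]

lemma ellipticF_add_pi (θ : ℝ) : ellipticF m (θ + Real.pi) = ellipticF m θ + 2 * ellipticK m := by
  have h := (periodic_ellipticF_integrand m).intervalIntegral_add_eq_add 0 θ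
    (intervalIntegrable_ellipticF_integrand hm)
  rwa [zero_add, ← ellipticF, ← ellipticF, ← ellipticF, ellipticF_pi hm] at h

lemma ellipticF_int_mul_pi (n : ℤ) : ellipticF m (n * Real.pi) = n * (2 * ellipticK m) := by
  have h := (periodic_ellipticF_integrand m).intervalIntegral_add_zsmul_eq n 0
    (intervalIntegrable_ellipticF_integrand hm)
  simp only [zero_add, zsmul_eq_mul] at h
  rwa [← ellipticF, ← ellipticF, ellipticF_pi hm] at h

lemma ellipticF_jacobiAm (x : ℝ) : ellipticF m (jacobiAm m x) = x :=
  Function.rightInverse_invFun (surjective_ellipticF hm) x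

lemma jacobiAm_ellipticF (θ : ℝ) : jacobiAm m (ellipticF m θ) = θ :=
  Function.leftInverse_invFun (strictMono_ellipticF hm).injective θ

lemma continuous_jacobiAm : Continuous (jacobiAm m) := by
  refine Monotone.continuous_of_surjective (fun x y hxy ↦ ?_)
    (fun θ ↦ ⟨_, jacobiAm_ellipticF hm θ⟩)
  rwa [← (strictMono_ellipticF hm).le_iff_le, ellipticF_jacobiAm hm, ellipticF_jacobiAm hm]

lemma continuous_jacobiSn : Continuous (jacobiSn m) :=
  Real.continuous_sin.comp (continuous_jacobiAm hm)

lemma continuous_jacobiCn : Continuous (jacobiCn m) :=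
  Real.continuous_cos.comp (continuous_jacobiAm hm)

lemma jacobiAm_zero : jacobiAm m 0 = 0 := by
  simpa only [ellipticF_zero] using jacobiAm_ellipticF hm 0

lemma jacobiAm_add_two_mul_ellipticK (x : ℝ) :
    jacobiAm m (x + 2 * ellipticK m) = jacobiAm m x + Real.pi := by
  apply (strictMono_ellipticF hm).injective
  rw [ellipticF_add_pi hm, ellipticF_jacobiAm hm, ellipticF_jacobiAm hm]

lemma jacobiDn_sq (x : ℝ) : jacobiDn m x ^ 2 = 1 - m * jacobiSn m x ^ 2 :=
  Real.sq_sqrt (one_sub_mul_sin_sq_pos hm _).le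

lemma jacobiDn_pos (x : ℝ) : 0 < jacobiDn m x :=
  Real.sqrt_pos.mpr (one_sub_mul_sin_sq_pos hm _)

lemma jacobiSn_zero : jacobiSn m 0 = 0 := by
  rw [jacobiSn, jacobiAm_zero hm, Real.sin_zero]

lemma jacobiCn_zero : jacobiCn m 0 = 1 := by
  rw [jacobiCn, jacobiAm_zero hm, Real.cos_zero]

lemma jacobiDn_zero : jacobiDn m 0 = 1 := by
  simp [jacobiDn, jacobiSn_zero hm]

lemma hasDerivAt_jacobiAm (x : ℝ) : HasDerivAt (jacobiAm m) (jacobiDn m x) x := by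
  have h := HasDerivAt.of_local_left_inverse (continuous_jacobiAm hm).continuousAt
    (hasDerivAt_ellipticF hm (jacobiAm m x)) (ellipticF_integrand_pos hm _).ne'
    (Eventually.of_forall (ellipticF_jacobiAm hm))
  rwa [one_div, inv_inv] at h

lemma hasDerivAt_jacobiSn (x : ℝ) : HasDerivAt (jacobiSn m) (jacobiCn m x * jacobiDn m x) x :=
  (hasDerivAt_jacobiAm hm x).sin

lemma hasDerivAt_jacobiCn (x : ℝ) : HasDerivAt (jacobiCn m) (-jacobiSn m x * jacobiDn m x) x :=
  (hasDerivAt_jacobiAm hm x).cos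

lemma hasDerivAt_jacobiDn (x : ℝ) :
    HasDerivAt (jacobiDn m) (-m * jacobiSn m x * jacobiCn m x) x := by
  have hpos := jacobiDn_pos hm x
  refine (((((hasDerivAt_jacobiSn hm x).pow 2).const_mul m).const_sub 1).sqrt
    (one_sub_mul_sin_sq_pos hm _).ne').congr_deriv ?_
  change _ / (2 * jacobiDn m x) = _
  field

lemma jacobiSn_add_two_mul_ellipticK (x : ℝ) :
    jacobiSn m (x + 2 * ellipticK m) = -jacobiSn m x := by
  rw [jacobiSn, jacobiAm_add_two_mul_ellipticK hm, Real.sin_add_pi, jacobiSn]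

lemma jacobiCn_add_two_mul_ellipticK (x : ℝ) :
    jacobiCn m (x + 2 * ellipticK m) = -jacobiCn m x := by
  rw [jacobiCn, jacobiAm_add_two_mul_ellipticK hm, Real.cos_add_pi, jacobiCn]

lemma jacobiDn_add_two_mul_ellipticK (x : ℝ) :
    jacobiDn m (x + 2 * ellipticK m) = jacobiDn m x := by
  rw [jacobiDn, jacobiSn_add_two_mul_ellipticK hm, neg_sq, jacobiDn]

lemma exists_eq_int_mul_of_jacobiSn_eq_zero {x : ℝ} (h : jacobiSn m x = 0) :
    ∃ n : ℤ, x = n * (2 * ellipticK m) := by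
  obtain ⟨n, hn⟩ := Real.sin_eq_zero_iff.mp h
  exact ⟨n, by rw [← ellipticF_int_mul_pi hm, hn, ellipticF_jacobiAm hm]⟩

end Real

/-! ### Complex Jacobi elliptic functions -/

lemma hasDerivAt_of_cauchyRiemann {f : ℂ → ℂ} {f' z : ℂ} (hf : DifferentiableAt ℝ f z)
    (hre : HasDerivAt (fun x : ℝ ↦ f ⟨x, z.im⟩) f' z.re)
    (him : HasDerivAt (fun y : ℝ ↦ f ⟨z.re, y⟩) (Complex.I * f') z.im) : HasDerivAt f f' z := by
  have hone : HasLineDerivAt ℝ f f' z 1 := by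
    have h := HasDerivAt.comp_const_add z.re 0 (by simpa using hre)
    refine h.congr_of_eventuallyEq (Eventually.of_forall fun t ↦ congrArg f ?_)
    simp [Complex.ext_iff]
  have hI : HasLineDerivAt ℝ f (Complex.I * f') z Complex.I := by
    have h := HasDerivAt.comp_const_add z.im 0 (by simpa using him)
    refine h.congr_of_eventuallyEq (Eventually.of_forall fun t ↦ congrArg f ?_)
    simp [Complex.ext_iff]
  have hcr : fderiv ℝ f z Complex.I = Complex.I • fderiv ℝ f z 1 := by
    rw [← hf.lineDeriv_eq_fderiv, ← hf.lineDeriv_eq_fderiv, hone.lineDeriv, hI.lineDeriv,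
      smul_eq_mul]
  rw [← hone.lineDeriv, hf.lineDeriv_eq_fderiv]
  exact (hf.hasFDerivAt.complexOfReal_hasFDerivAt hcr).hasDerivAt

/-- The common denominator of the complex functions `sn`, `cn`, `dn` with parameter `m`. -/
def snDenom (m : ℝ) (z : ℂ) : ℝ :=
  jacobiCn (1 - m) z.im ^ 2 + m * jacobiSn m z.re ^ 2 * jacobiSn (1 - m) z.im ^ 2

/-- The numerator of `‖sn z‖²` when it is written with denominator `snDenom m z`. -/
def snNumer (m : ℝ) (z : ℂ) : ℝ :=
  jacobiSn (1 - m) z.im ^ 2 + jacobiSn m z.re ^ 2 * jacobiCn (1 - m) z.im ^ 2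

/-- The Jacobi elliptic function `sn` of a complex variable with parameter `m`, obtained from the
real functions by the addition theorem and Jacobi's imaginary transformation. Its value at the
poles is `0`. -/
def complexSn (m : ℝ) (z : ℂ) : ℂ :=
  (jacobiSn m z.re * jacobiDn (1 - m) z.im +
    jacobiCn m z.re * jacobiDn m z.re * (jacobiSn (1 - m) z.im * jacobiCn (1 - m) z.im) *
      Complex.I) / snDenom m z

/-- The Jacobi elliptic function `cn` of a complex variable, encoded like `complexSn`. -/
def complexCn (m : ℝ) (z : ℂ) : ℂ :=
  (jacobiCn m z.re * jacobiCn (1 - m) z.im -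
    jacobiSn m z.re * jacobiDn m z.re * (jacobiSn (1 - m) z.im * jacobiDn (1 - m) z.im) *
      Complex.I) / snDenom m z

/-- The Jacobi elliptic function `dn` of a complex variable, encoded like `complexSn`. -/
def complexDn (m : ℝ) (z : ℂ) : ℂ :=
  (jacobiDn m z.re * jacobiCn (1 - m) z.im * jacobiDn (1 - m) z.im -
    m * jacobiSn m z.re * jacobiCn m z.re * jacobiSn (1 - m) z.im * Complex.I) / snDenom m z

section Complex

lemma ofReal_jacobiCn_sq (m x : ℝ) : (jacobiCn m x : ℂ) ^ 2 = 1 - jacobiSn m x ^ 2 :=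
  mod_cast jacobiCn_sq m x

lemma ofReal_jacobiDn_sq {m : ℝ} (hm : m < 1) (x : ℝ) :
    (jacobiDn m x : ℂ) ^ 2 = 1 - m * jacobiSn m x ^ 2 :=
  mod_cast jacobiDn_sq hm x

lemma snDenom_add_two_mul_ellipticK {m : ℝ} (hm : m < 1) (z : ℂ) :
    snDenom m (z + 2 * ellipticK m) = snDenom m z := by
  simp [snDenom, jacobiSn_add_two_mul_ellipticK hm]

lemma complexSn_add_two_mul_ellipticK {m : ℝ} (hm : m < 1) (z : ℂ) :
    complexSn m (z + 2 * ellipticK m) = -complexSn m z := by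
  rw [complexSn, complexSn, snDenom_add_two_mul_ellipticK hm, ← neg_div]
  simp [jacobiSn_add_two_mul_ellipticK hm, jacobiCn_add_two_mul_ellipticK hm,
    jacobiDn_add_two_mul_ellipticK hm, add_comm]

variable {m : ℝ} {z : ℂ} (hm₀ : 0 < m)
include hm₀

lemma snDenom_eq_zero_iff :
    snDenom m z = 0 ↔ jacobiSn m z.re = 0 ∧ jacobiCn (1 - m) z.im = 0 := by
  have h := jacobiCn_sq (1 - m) z.im
  rw [snDenom, add_eq_zero_iff_of_nonneg (by positivity) (by positivity)]
  constructor
  · rintro ⟨hc, hs⟩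
    rw [hc, eq_comm, sub_eq_zero, eq_comm] at h
    rw [h, mul_one, mul_eq_zero, or_iff_right hm₀.ne'] at hs
    exact ⟨pow_eq_zero_iff two_ne_zero |>.mp hs, pow_eq_zero_iff two_ne_zero |>.mp hc⟩
  · rintro ⟨hs, hc⟩
    simp [hs, hc]

lemma snNumer_eq_one_of_snDenom_eq_zero (hz : snDenom m z = 0) : snNumer m z = 1 := by
  obtain ⟨-, hc⟩ := (snDenom_eq_zero_iff hm₀).mp hz
  have h := jacobiCn_sq (1 - m) z.im
  rw [snNumer, hc]
  linear_combination h - jacobiCn (1 - m) z.im * hc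

lemma snDenom_add_two_mul_I_mul_ellipticK (z : ℂ) :
    snDenom m (z + 2 * Complex.I * ellipticK (1 - m)) = snDenom m z := by
  have hm' := sub_lt_self 1 hm₀
  simp [snDenom, jacobiSn_add_two_mul_ellipticK hm', jacobiCn_add_two_mul_ellipticK hm']

lemma complexSn_add_two_mul_I_mul_ellipticK (z : ℂ) :
    complexSn m (z + 2 * Complex.I * ellipticK (1 - m)) = complexSn m z := by
  have hm' := sub_lt_self 1 hm₀
  rw [complexSn, complexSn, snDenom_add_two_mul_I_mul_ellipticK hm₀]
  simp [jacobiSn_add_two_mul_ellipticK hm', jacobiCn_add_two_mul_ellipticK hm',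
    jacobiDn_add_two_mul_ellipticK hm']

lemma snDenom_ofReal (t : ℝ) : snDenom m t = 1 := by
  have hm' := sub_lt_self 1 hm₀
  simp [snDenom, jacobiSn_zero hm', jacobiCn_zero hm']

lemma complexSn_ofReal (t : ℝ) : complexSn m t = jacobiSn m t := by
  have hm' := sub_lt_self 1 hm₀
  simp [complexSn, snDenom_ofReal hm₀, jacobiSn_zero hm', jacobiDn_zero hm']

variable (hm : m < 1)
include hm

lemma differentiableAt_complexSn_real (hz : snDenom m z ≠ 0) :
    DifferentiableAt ℝ (complexSn m) z := by
  have hm' := sub_lt_self 1 hm₀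
  have hre : HasFDerivAt Complex.re Complex.reCLM z := Complex.reCLM.hasFDerivAt
  have him : HasFDerivAt Complex.im Complex.imCLM z := Complex.imCLM.hasFDerivAt
  have hs := ((hasDerivAt_jacobiSn hm z.re).comp_hasFDerivAt z hre).differentiableAt
  have hc := ((hasDerivAt_jacobiCn hm z.re).comp_hasFDerivAt z hre).differentiableAt
  have hd := ((hasDerivAt_jacobiDn hm z.re).comp_hasFDerivAt z hre).differentiableAt
  have hs' := ((hasDerivAt_jacobiSn hm' z.im).comp_hasFDerivAt z him).differentiableAt
  have hc' := ((hasDerivAt_jacobiCn hm' z.im).comp_hasFDerivAt z him).differentiableAt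
  have hd' := ((hasDerivAt_jacobiDn hm' z.im).comp_hasFDerivAt z him).differentiableAt
  have hD : DifferentiableAt ℝ (snDenom m) z :=
    (hc'.pow 2).add (((hs.pow 2).const_mul m).mul (hs'.pow 2))
  have hofReal {f : ℂ → ℝ} (hf : DifferentiableAt ℝ f z) :
      DifferentiableAt ℝ (fun w ↦ (f w : ℂ)) z := Complex.ofRealCLM.differentiableAt.comp z hf
  have hnum := ((hofReal hs).mul (hofReal hd')).add ((((hofReal hc).mul (hofReal hd)).mul
    ((hofReal hs').mul (hofReal hc'))).mul_const Complex.I)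
  exact hnum.mul (DifferentiableAt.fun_inv (hofReal hD) (Complex.ofReal_ne_zero.mpr hz))

lemma hasDerivAt_complexSn_re {x y : ℝ} (hz : snDenom m ⟨x, y⟩ ≠ 0) :
    HasDerivAt (fun x : ℝ ↦ complexSn m ⟨x, y⟩) (complexCn m ⟨x, y⟩ * complexDn m ⟨x, y⟩) x := by
  have hs := (hasDerivAt_jacobiSn hm x).ofReal_comp
  have hc := (hasDerivAt_jacobiCn hm x).ofReal_comp
  have hd := (hasDerivAt_jacobiDn hm x).ofReal_comp
  have hnum : HasDerivAt (fun x : ℝ ↦ (jacobiSn m x * jacobiDn (1 - m) y +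
      jacobiCn m x * jacobiDn m x * (jacobiSn (1 - m) y * jacobiCn (1 - m) y) * Complex.I : ℂ))
      _ x := (hs.mul_const _).add (((hc.mul hd).mul_const _).mul_const Complex.I)
  have hden : HasDerivAt (fun x : ℝ ↦ (snDenom m ⟨x, y⟩ : ℂ)) _ x :=
    ((((hasDerivAt_jacobiSn hm x).pow 2).const_mul m).mul_const
      (jacobiSn (1 - m) y ^ 2)).const_add (jacobiCn (1 - m) y ^ 2) |>.ofReal_comp
  refine (hnum.fun_div hden (Complex.ofReal_ne_zero.mpr hz)).congr_deriv ?_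
  rw [complexCn, complexDn, div_mul_div_comm, ← sq]
  simp only [snDenom]
  push_cast
  congr 1
  have hI := Complex.I_sq
  have hc_sq := ofReal_jacobiCn_sq m x
  have hd_sq := ofReal_jacobiDn_sq hm x
  have hc'_sq := ofReal_jacobiCn_sq (1 - m) y
  have hd'_sq := ofReal_jacobiDn_sq (sub_lt_self 1 hm₀) y
  push_cast at hd'_sq
  clear * - hI hc_sq hd_sq hc'_sq hd'_sq
  generalize (jacobiSn m x : ℂ) = s at *
  generalize (jacobiCn m x : ℂ) = c at *
  generalize (jacobiDn m x : ℂ) = d at *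
  generalize (jacobiSn (1 - m) y : ℂ) = s' at *
  generalize (jacobiCn (1 - m) y : ℂ) = c' at *
  generalize (jacobiDn (1 - m) y : ℂ) = d' at *
  grind

lemma hasDerivAt_complexSn_im {x y : ℝ} (hz : snDenom m ⟨x, y⟩ ≠ 0) :
    HasDerivAt (fun y : ℝ ↦ complexSn m ⟨x, y⟩)
      (Complex.I * (complexCn m ⟨x, y⟩ * complexDn m ⟨x, y⟩)) y := by
  have hm' := sub_lt_self 1 hm₀
  have hs := (hasDerivAt_jacobiSn hm' y).ofReal_comp
  have hc := (hasDerivAt_jacobiCn hm' y).ofReal_comp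
  have hd := (hasDerivAt_jacobiDn hm' y).ofReal_comp
  have hnum : HasDerivAt (fun y : ℝ ↦ (jacobiSn m x * jacobiDn (1 - m) y +
      jacobiCn m x * jacobiDn m x * (jacobiSn (1 - m) y * jacobiCn (1 - m) y) * Complex.I : ℂ))
      _ y := (hd.const_mul _).add (((hs.mul hc).const_mul _).mul_const Complex.I)
  have hden : HasDerivAt (fun y : ℝ ↦ (snDenom m ⟨x, y⟩ : ℂ)) _ y :=
    ((hasDerivAt_jacobiCn hm' y).pow 2).add (((hasDerivAt_jacobiSn hm' y).pow 2).const_mul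
      (m * jacobiSn m x ^ 2)) |>.ofReal_comp
  refine (hnum.fun_div hden (Complex.ofReal_ne_zero.mpr hz)).congr_deriv ?_
  rw [complexCn, complexDn, div_mul_div_comm, ← sq, mul_div_assoc']
  simp only [snDenom]
  push_cast
  congr 1
  have hI := Complex.I_sq
  have hc_sq := ofReal_jacobiCn_sq m x
  have hd_sq := ofReal_jacobiDn_sq hm x
  have hc'_sq := ofReal_jacobiCn_sq (1 - m) y
  have hd'_sq := ofReal_jacobiDn_sq (sub_lt_self 1 hm₀) y
  push_cast at hd'_sq
  clear * - hI hc_sq hd_sq hc'_sq hd'_sq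
  generalize (jacobiSn m x : ℂ) = s at *
  generalize (jacobiCn m x : ℂ) = c at *
  generalize (jacobiDn m x : ℂ) = d at *
  generalize (jacobiSn (1 - m) y : ℂ) = s' at *
  generalize (jacobiCn (1 - m) y : ℂ) = c' at *
  generalize (jacobiDn (1 - m) y : ℂ) = d' at *
  grind

lemma hasDerivAt_complexSn (hz : snDenom m z ≠ 0) :
    HasDerivAt (complexSn m) (complexCn m z * complexDn m z) z :=
  hasDerivAt_of_cauchyRiemann (differentiableAt_complexSn_real hm₀ hm hz)
    (hasDerivAt_complexSn_re hm₀ hm hz) (hasDerivAt_complexSn_im hm₀ hm hz)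

lemma continuous_snDenom : Continuous (snDenom m) := by
  have hs := (continuous_jacobiSn hm).comp Complex.continuous_re
  have hs' := (continuous_jacobiSn (sub_lt_self 1 hm₀)).comp Complex.continuous_im
  have hc' := (continuous_jacobiCn (sub_lt_self 1 hm₀)).comp Complex.continuous_im
  exact (hc'.pow 2).add ((continuous_const.mul (hs.pow 2)).mul (hs'.pow 2))

lemma continuous_snNumer : Continuous (snNumer m) := by
  have hs := (continuous_jacobiSn hm).comp Complex.continuous_re
  have hs' := (continuous_jacobiSn (sub_lt_self 1 hm₀)).comp Complex.continuous_im
  have hc' := (continuous_jacobiCn (sub_lt_self 1 hm₀)).comp Complex.continuous_im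
  exact (hs'.pow 2).add ((hs.pow 2).mul (hc'.pow 2))

lemma norm_complexSn_sq : ‖complexSn m z‖ ^ 2 = snNumer m z / snDenom m z := by
  rcases eq_or_ne (snDenom m z) 0 with hz | hz
  · simp [complexSn, hz]
  have hnum : ‖complexSn m z‖ ^ 2 = ((jacobiSn m z.re * jacobiDn (1 - m) z.im) ^ 2 +
      (jacobiCn m z.re * jacobiDn m z.re * (jacobiSn (1 - m) z.im * jacobiCn (1 - m) z.im)) ^ 2) /
        snDenom m z ^ 2 := by
    rw [complexSn, norm_div, div_pow, ← Complex.normSq_eq_norm_sq, Complex.norm_real,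
      Real.norm_eq_abs, sq_abs, ← Complex.normSq_add_mul_I]
    push_cast
    rfl
  rw [hnum, div_eq_div_iff (pow_ne_zero 2 hz) hz]
  simp only [mul_pow, snNumer, snDenom, jacobiCn_sq, jacobiDn_sq hm,
    jacobiDn_sq (sub_lt_self 1 hm₀)]
  ring

lemma eventually_snDenom_ne_zero (z : ℂ) : ∀ᶠ w in 𝓝[≠] z, snDenom m w ≠ 0 := by
  rcases ne_or_eq (snDenom m z) 0 with hz | hz
  · exact ((continuous_snDenom hm₀ hm).continuousAt.eventually_ne hz).filter_mono
      nhdsWithin_le_nhds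
  obtain ⟨hs, hc'⟩ := (snDenom_eq_zero_iff hm₀).mp hz
  have hc : jacobiCn m z.re ≠ 0 := by
    intro hc
    simpa [hs, hc] using jacobiCn_sq m z.re
  have hs' : jacobiSn (1 - m) z.im ≠ 0 := by
    intro hs'
    simpa [hs', hc'] using jacobiCn_sq (1 - m) z.im
  have hm' := sub_lt_self 1 hm₀
  have hsn := (hasDerivAt_jacobiSn hm z.re).eventually_ne (c := 0)
    (mul_ne_zero hc (jacobiDn_pos hm _).ne')
  have hcn := (hasDerivAt_jacobiCn hm' z.im).eventually_ne (c := 0)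
    (mul_ne_zero (neg_ne_zero.mpr hs') (jacobiDn_pos hm' _).ne')
  rw [eventually_nhdsWithin_iff] at hsn hcn ⊢
  filter_upwards [Complex.continuous_re.continuousAt.eventually hsn,
    Complex.continuous_im.continuousAt.eventually hcn] with w hre him hne hw
  obtain ⟨hs, hc'⟩ := (snDenom_eq_zero_iff hm₀).mp hw
  exact hne (Complex.ext (by_contra fun h ↦ hre h hs) (by_contra fun h ↦ him h hc'))

lemma analyticAt_complexSn (hz : snDenom m z ≠ 0) : AnalyticAt ℂ (complexSn m) z :=
  Complex.analyticAt_iff_eventually_differentiableAt.mpr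
    (((continuous_snDenom hm₀ hm).continuousAt.eventually_ne hz).mono
      fun _ hw ↦ (hasDerivAt_complexSn hm₀ hm hw).differentiableAt)

lemma eventually_complexSn_ne_zero (hz : snDenom m z = 0) :
    ∀ᶠ w in 𝓝[≠] z, complexSn m w ≠ 0 := by
  have hnum : snNumer m z ≠ 0 := by simp [snNumer_eq_one_of_snDenom_eq_zero hm₀ hz]
  filter_upwards [eventually_snDenom_ne_zero hm₀ hm z, ((continuous_snNumer hm₀
    hm).continuousAt.eventually_ne hnum).filter_mono nhdsWithin_le_nhds] with w hden hnum hw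
  exact div_ne_zero hnum hden (by simp [← norm_complexSn_sq hm₀ hm, hw])

lemma analyticAt_complexSn_inv (hz : snDenom m z = 0) :
    AnalyticAt ℂ (fun w ↦ (complexSn m w)⁻¹) z := by
  apply Complex.analyticAt_of_differentiable_on_punctured_nhds_of_continuousAt
  · filter_upwards [eventually_snDenom_ne_zero hm₀ hm z, eventually_complexSn_ne_zero hm₀ hm hz]
      with w hden hsn
    exact (hasDerivAt_complexSn hm₀ hm hden).differentiableAt.inv hsn
  · have hnorm (w : ℂ) : ‖(complexSn m w)⁻¹‖ = √(snDenom m w / snNumer m w) := by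
      rw [norm_inv, ← inv_div, ← norm_complexSn_sq hm₀ hm, Real.sqrt_inv,
        Real.sqrt_sq (norm_nonneg _)]
    have hlim := ((continuous_snDenom hm₀ hm).continuousAt (x := z)).div
      (continuous_snNumer hm₀ hm).continuousAt
      (by simp [snNumer_eq_one_of_snDenom_eq_zero hm₀ hz])
    rw [ContinuousAt, complexSn, hz, Complex.ofReal_zero, div_zero, inv_zero,
      tendsto_zero_iff_norm_tendsto_zero]
    simpa [hnorm, hz] using hlim.tendsto.sqrt

lemma exists_eq_lattice_of_complexSn_eq_zero (hz : snDenom m z ≠ 0) (hsn : complexSn m z = 0) :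
    ∃ n k : ℤ, z = n * (2 * ellipticK m) + k * (2 * Complex.I * ellipticK (1 - m)) := by
  have hnum := norm_complexSn_sq hm₀ hm (z := z)
  rw [hsn, norm_zero, zero_pow two_ne_zero, eq_comm, div_eq_zero_iff, or_iff_left hz, snNumer,
    add_eq_zero_iff_of_nonneg (by positivity) (by positivity), sq_eq_zero_iff] at hnum
  obtain ⟨hs', hs⟩ := hnum
  rw [jacobiCn_sq, hs', zero_pow two_ne_zero, sub_zero, mul_one, sq_eq_zero_iff] at hs
  obtain ⟨n, hn⟩ := exists_eq_int_mul_of_jacobiSn_eq_zero hm hs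
  obtain ⟨k, hk⟩ := exists_eq_int_mul_of_jacobiSn_eq_zero (sub_lt_self 1 hm₀) hs'
  exact ⟨n, k, Complex.ext (by simp [hn]) (by simp [hk])⟩

end Complex

/-- The elliptic function `1 - 2 c sn²` of parameter `m`, with the value `0` at its poles. -/
def snForm (m : ℝ) (c z : ℂ) : ℂ :=
  if snDenom m z = 0 then 0 else 1 - 2 * c * complexSn m z ^ 2

section SnForm

variable {m : ℝ} {c z : ℂ} (hm₀ : 0 < m)
include hm₀

lemma snForm_ofReal (t : ℝ) : snForm m c t = 1 - 2 * c * (jacobiSn m t : ℂ) ^ 2 := by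
  rw [snForm, if_neg (by simp [snDenom_ofReal hm₀]), complexSn_ofReal hm₀]

variable (hm : m < 1)
include hm

lemma snForm_zero : snForm m c 0 = 1 := by
  simpa [jacobiSn_zero hm] using snForm_ofReal (c := c) hm₀ 0

lemma analyticAt_snForm (hz : snDenom m z ≠ 0) : AnalyticAt ℂ (snForm m c) z := by
  have h : AnalyticAt ℂ (fun w ↦ 1 - 2 * c * complexSn m w ^ 2) z :=
    analyticAt_const.sub (analyticAt_const.mul ((analyticAt_complexSn hm₀ hm hz).pow 2))
  refine h.congr ?_
  filter_upwards [(continuous_snDenom hm₀ hm).continuousAt.eventually_ne hz] with w hw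
  rw [snForm, if_neg hw]

lemma meromorphicNFAt_snForm_of_snDenom_eq_zero (hc : c ≠ 0) (hz : snDenom m z = 0) :
    MeromorphicNFAt (snForm m c) z := by
  have hsn : complexSn m z = 0 := by simp [complexSn, hz]
  have hinv := (analyticAt_complexSn_inv hm₀ hm hz).pow 2
  have hrecip : AnalyticAt ℂ
      (fun w ↦ (complexSn m w)⁻¹ ^ 2 / ((complexSn m w)⁻¹ ^ 2 - 2 * c)) z :=
    hinv.div (hinv.sub analyticAt_const) (by simpa [hsn] using hc)
  refine (meromorphicNFAt_congr ?_).mpr hrecip.meromorphicNFAt.inv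
  have hden := eventually_snDenom_ne_zero hm₀ hm z
  have hne := eventually_complexSn_ne_zero hm₀ hm hz
  rw [eventually_nhdsWithin_iff] at hden hne
  filter_upwards [hden, hne] with w hden hne
  rcases eq_or_ne w z with rfl | hw
  · simp [snForm, hz, hsn]
  · have := hne hw
    rw [snForm, if_neg (hden hw), Pi.inv_apply, inv_div]
    field_simp

lemma meromorphicNFAt_snForm (hc : c ≠ 0) (z : ℂ) : MeromorphicNFAt (snForm m c) z := by
  rcases eq_or_ne (snDenom m z) 0 with hz | hz
  · exact meromorphicNFAt_snForm_of_snDenom_eq_zero hm₀ hm hc hz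
  · exact (analyticAt_snForm hm₀ hm hz).meromorphicNFAt

omit hm₀ in
lemma periodic_snForm_two_mul_ellipticK :
    Function.Periodic (snForm m c) (2 * ellipticK m) := fun z ↦ by
  rw [snForm, snForm, snDenom_add_two_mul_ellipticK hm, complexSn_add_two_mul_ellipticK hm, neg_sq]

omit hm in
lemma periodic_snForm_two_mul_I_mul_ellipticK :
    Function.Periodic (snForm m c) (2 * Complex.I * ellipticK (1 - m)) := fun z ↦ by
  rw [snForm, snForm, snDenom_add_two_mul_I_mul_ellipticK hm₀,
    complexSn_add_two_mul_I_mul_ellipticK hm₀]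

lemma periodic_snForm_iff (hc : c ≠ 0) (w : ℂ) :
    Function.Periodic (snForm m c) w ↔ ∃ n k : ℤ,
      w = n * (2 * ellipticK m) + k * (2 * Complex.I * ellipticK (1 - m)) := by
  constructor
  · intro hp
    have hw : snForm m c w = 1 := by rw [← zero_add w, hp 0, snForm_zero hm₀ hm]
    have hden : snDenom m w ≠ 0 := by
      intro hden
      simp [snForm, hden] at hw
    exact exists_eq_lattice_of_complexSn_eq_zero hm₀ hm hden (by simpa [snForm, hden, hc] using hw)
  · rintro ⟨n, k, rfl⟩
    exact ((periodic_snForm_two_mul_ellipticK hm).int_mul n).add_period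
      ((periodic_snForm_two_mul_I_mul_ellipticK hm₀).int_mul k)

end SnForm

/-! ### Identification of `cos ψ` -/

lemma eventuallyEq_of_hasDerivAt_of_contDiffAt {E : Type*} [NormedAddCommGroup E]
    [NormedSpace ℝ E] {v : E → E} {f g : ℝ → E} {t₀ : ℝ} (hv : ContDiffAt ℝ 1 v (f t₀))
    (hf : ∀ᶠ t in 𝓝 t₀, HasDerivAt f (v (f t)) t) (hg : ∀ᶠ t in 𝓝 t₀, HasDerivAt g (v (g t)) t)
    (h₀ : f t₀ = g t₀) : f =ᶠ[𝓝 t₀] g := by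
  obtain ⟨K, s, hs, hlip⟩ := hv.exists_lipschitzOnWith
  exact ODE_solution_unique_of_eventually (v := fun _ ↦ v) (s := fun _ ↦ s)
    (Eventually.of_forall fun _ ↦ hlip)
    (hf.and (hf.self_of_nhds.continuousAt.eventually_mem hs))
    (hg.and (hg.self_of_nhds.continuousAt.eventually_mem (h₀ ▸ hs))) h₀

lemma eventuallyEq_of_eventually_ofReal_eq {f g : ℂ → ℂ} {x : ℝ} (hf : AnalyticAt ℂ f x)
    (hg : AnalyticAt ℂ g x) (h : ∀ᶠ t : ℝ in 𝓝 x, f t = g t) : f =ᶠ[𝓝 (x : ℂ)] g := by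
  refine (hf.frequently_eq_iff_eventually_eq hg).mp ?_
  have hlim : Tendsto (fun t : ℝ ↦ (t : ℂ)) (𝓝[≠] x) (𝓝[≠] (x : ℂ)) :=
    Complex.continuous_ofReal.continuousWithinAt.tendsto_nhdsWithin fun _ _ ↦ by simp_all
  exact hlim.frequently (h.filter_mono nhdsWithin_le_nhds).frequently

lemma hasDerivAt_const_mul_jacobiSn {m : ℝ} (hm : m < 1) (a b t : ℝ) :
    HasDerivAt (fun t ↦ b * jacobiSn m (a * t))
      (a * b * (jacobiCn m (a * t) * jacobiDn m (a * t))) t :=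
  (((hasDerivAt_jacobiSn hm (a * t)).comp t (hasDerivAt_const_mul a)).const_mul b).congr_deriv
    (by ring)

lemma hasDerivAt_const_mul_jacobiCn_mul_jacobiDn {m a b : ℝ} (hm : m < 1)
    (ha : a ^ 2 * (1 + m) = 1) (hb : a ^ 2 * m = b ^ 2) (t : ℝ) :
    HasDerivAt (fun t ↦ a * b * (jacobiCn m (a * t) * jacobiDn m (a * t)))
      (-(b * jacobiSn m (a * t)) + 2 * (b * jacobiSn m (a * t)) ^ 3) t := by
  have hc := (hasDerivAt_jacobiCn hm (a * t)).comp t (hasDerivAt_const_mul a)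
  have hd := (hasDerivAt_jacobiDn hm (a * t)).comp t (hasDerivAt_const_mul a)
  refine ((hc.mul hd).const_mul (a * b)).congr_deriv ?_
  simp only [Function.comp_apply]
  linear_combination (-b * a ^ 2 * jacobiSn m (a * t)) * jacobiDn_sq hm (a * t)
    - b * a ^ 2 * m * jacobiSn m (a * t) * jacobiCn_sq m (a * t) - b * jacobiSn m (a * t) * ha
    + 2 * b * jacobiSn m (a * t) ^ 3 * hb

section Identification

variable {κ m a b : ℝ} {φ ψ : ℂ → ℂ} (hm : m < 1) (ha : a ^ 2 * (1 + m) = 1)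
  (hb : a ^ 2 * m = b ^ 2) (hab : a * b = κ / 2)
include hm ha hb hab

lemma IsAuxiliaryAngle.sin_half_eq_jacobiSn (hψ : IsAuxiliaryAngle κ φ ψ)
    (hφ : IsLocalAmplitude κ φ) :
    ∀ᶠ t : ℝ in 𝓝 0, Complex.sin (ψ t / 2) = b * jacobiSn m (a * t) := by
  let v : ℂ × ℂ → ℂ × ℂ := fun p ↦ (p.2, -p.1 + 2 * p.1 ^ 3)
  have hv : ContDiff ℝ 1 v := by fun_prop
  let f : ℝ → ℂ × ℂ := fun t ↦ (Complex.sin (ψ t / 2), κ / 2 * Complex.cos (φ t))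
  let g : ℝ → ℂ × ℂ := fun t ↦ ((b * jacobiSn m (a * t) : ℝ),
    (a * b * (jacobiCn m (a * t) * jacobiDn m (a * t)) : ℝ))
  have hlim : Tendsto (fun t : ℝ ↦ (t : ℂ)) (𝓝 0) (𝓝 0) := by
    simpa using Complex.continuous_ofReal.tendsto 0
  have hf : ∀ᶠ t in 𝓝 0, HasDerivAt f (v (f t)) t := by
    filter_upwards [hlim.eventually (hψ.hasDerivAt_sin_half hφ),
      hlim.eventually (hψ.hasDerivAt_cos_amplitude hφ)] with t hsin hcos
    exact hsin.comp_ofReal.prodMk hcos.comp_ofReal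
  have hg (t : ℝ) : HasDerivAt g (v (g t)) t :=
    ((hasDerivAt_const_mul_jacobiSn hm a b t).ofReal_comp.prodMk
      (hasDerivAt_const_mul_jacobiCn_mul_jacobiDn hm ha hb t).ofReal_comp).congr_deriv
        (by simp [v, g])
  have h₀ : f 0 = g 0 := by
    simp [f, g, hψ.map_zero, hφ.map_zero, jacobiSn_zero hm, jacobiCn_zero hm, jacobiDn_zero hm,
      hab]
  filter_upwards [eventuallyEq_of_hasDerivAt_of_contDiffAt hv.contDiffAt hf
    (Eventually.of_forall hg) h₀] with t ht
  simpa [f, g] using congrArg Prod.fst ht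

lemma IsAuxiliaryAngle.snForm_eq_cos (hm₀ : 0 < m) (hψ : IsAuxiliaryAngle κ φ ψ)
    (hφ : IsLocalAmplitude κ φ) :
    ∀ᶠ u in 𝓝 (0 : ℂ), snForm m (b ^ 2) (a * u) = Complex.cos (ψ u) := by
  have hform : AnalyticAt ℂ (fun u : ℂ ↦ snForm m (b ^ 2) (a * u)) ((0 : ℝ) : ℂ) :=
    AnalyticAt.fun_comp (f := fun u : ℂ ↦ (a : ℂ) * u)
      (analyticAt_snForm hm₀ hm
        (by simp only [← Complex.ofReal_mul, snDenom_ofReal hm₀, ne_eq, one_ne_zero,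
          not_false_eq_true])) (by fun_prop)
  have hcos : AnalyticAt ℂ (fun u ↦ Complex.cos (ψ u)) ((0 : ℝ) : ℂ) := by
    have := hψ.analyticAt
    simp only [Complex.ofReal_zero]
    fun_prop
  rw [← Complex.ofReal_zero]
  refine eventuallyEq_of_eventually_ofReal_eq hform hcos ?_
  filter_upwards [hψ.sin_half_eq_jacobiSn hm ha hb hab hφ] with t hsin
  have hhalf : Complex.cos (ψ t) = 1 - 2 * Complex.sin (ψ t / 2) ^ 2 := by
    rw [← Complex.cos_two_mul_eq_one_sub, mul_div_cancel₀ _ two_ne_zero]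
  rw [← Complex.ofReal_mul, snForm_ofReal hm₀, hhalf, hsin]
  ring

end Identification

/-- The function `dn₂` of modulus `κ = √(1 - lam ^ 2)`, expressed through Jacobi's `sn`. With
`m = (1 - lam) / (1 + lam)`, `a = √((1 + lam) / 2)` and `b = √((1 - lam) / 2)`, the function
`b * sn (a u | m)` solves the differential equation of `sin (ψ u / 2)`, and `dn₂` is the
resulting value of `cos ψ`. -/
def dnTwo (lam : ℝ) (u : ℂ) : ℂ :=
  snForm ((1 - lam) / (1 + lam)) ((1 - lam) / 2) (√((1 + lam) / 2) * u)

section DnTwo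

variable {lam : ℝ} (h₀ : 0 < lam)
include h₀

lemma modulus_lt_one : (1 - lam) / (1 + lam) < 1 :=
  (div_lt_one (by linarith)).mpr (by linarith)

lemma one_sub_modulus : 1 - (1 - lam) / (1 + lam) = 2 * lam / (1 + lam) := by
  have : 1 + lam ≠ 0 := by linarith
  field_simp
  ring

variable (h₁ : lam < 1)
include h₁

lemma modulus_pos : 0 < (1 - lam) / (1 + lam) :=
  div_pos (by linarith) (by linarith)

lemma meromorphicNFOn_dnTwo : MeromorphicNFOn (dnTwo lam) Set.univ := fun u _ ↦
  (meromorphicNFAt_snForm (modulus_pos h₀ h₁) (modulus_lt_one h₀)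
    (by exact_mod_cast (by linarith : (1 - lam) / 2 ≠ 0)) _).comp_analyticAt
    (g := fun u : ℂ ↦ (√((1 + lam) / 2) : ℂ) * u) (by fun_prop)

lemma IsAuxiliaryAngle.dnTwo_eq_cos {κ : ℝ} {φ ψ : ℂ → ℂ} (hψ : IsAuxiliaryAngle κ φ ψ)
    (hφ : IsLocalAmplitude κ φ) (hκ : 0 ≤ κ) (h : lam ^ 2 = 1 - κ ^ 2) :
    ∀ᶠ u in 𝓝 (0 : ℂ), dnTwo lam u = Complex.cos (ψ u) := by
  have hlam : 1 + lam ≠ 0 := by linarith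
  have ha : √((1 + lam) / 2) ^ 2 = (1 + lam) / 2 := Real.sq_sqrt (by linarith)
  have hb : √((1 - lam) / 2) ^ 2 = (1 - lam) / 2 := Real.sq_sqrt (by linarith)
  have hab : √((1 + lam) / 2) * √((1 - lam) / 2) = κ / 2 := by
    rw [← Real.sqrt_mul (by linarith), Real.sqrt_eq_iff_mul_self_eq (by nlinarith) (by linarith)]
    linear_combination -h / 4
  have hcos := hψ.snForm_eq_cos (modulus_lt_one h₀) (by rw [ha]; field_simp; ring)
    (by rw [ha, hb]; field_simp) hab (modulus_pos h₀ h₁) hφ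
  rw [← Complex.ofReal_pow, hb] at hcos
  simpa [dnTwo] using hcos

end DnTwo

lemma eqOn_of_meromorphicNFOn_of_eventuallyEq {𝕜 E : Type*} [NontriviallyNormedField 𝕜]
    [NormedAddCommGroup E] [NormedSpace 𝕜 E] [CompleteSpace E] {f g : 𝕜 → E} {U : Set 𝕜} {x : 𝕜}
    (hf : MeromorphicNFOn f U) (hg : MeromorphicNFOn g U) (hU : IsPreconnected U) (hx : x ∈ U)
    (h : f =ᶠ[𝓝 x] g) : Set.EqOn f g U := by
  intro z hz
  have hfg : MeromorphicOn (f - g) U := hf.meromorphicOn.sub hg.meromorphicOn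
  have htop : meromorphicOrderAt (f - g) z = ⊤ := by
    by_contra hne
    refine hfg.meromorphicOrderAt_ne_top_of_isPreconnected hU hz hx hne ?_
    exact meromorphicOrderAt_eq_top_iff.mpr
      ((h.filter_mono nhdsWithin_le_nhds).mono fun _ hw ↦ sub_eq_zero.mpr hw)
  have heq : f =ᶠ[𝓝[≠] z] g :=
    (meromorphicOrderAt_eq_top_iff.mp htop).mono fun _ hw ↦ sub_eq_zero.mp hw
  exact (((hf hz).eventuallyEq_nhdsNE_iff_eventuallyEq_nhds (hg hz)).mp heq).self_of_nhds

lemma isDn_iff {κ lam : ℝ} (h₀ : 0 < lam) (h₁ : lam < 1) (hκ : 0 ≤ κ) (h : lam ^ 2 = 1 - κ ^ 2)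
    (d : ℂ → ℂ) : IsDn κ d ↔ d = dnTwo lam := by
  have hdn := meromorphicNFOn_dnTwo h₀ h₁
  constructor
  · rintro ⟨hd, φ, ψ, hφ, hψ, hcos⟩
    have heq : d =ᶠ[𝓝 0] dnTwo lam := by
      filter_upwards [hcos, hψ.dnTwo_eq_cos h₀ h₁ hφ hκ h] with u hu hu'
      rw [hu, hu']
    exact Set.eqOn_univ _ _ |>.mp
      (eqOn_of_meromorphicNFOn_of_eventuallyEq hd hdn isPreconnected_univ (Set.mem_univ 0) heq)
  · rintro rfl
    obtain ⟨φ, hφ⟩ := exists_isLocalAmplitude κ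
    obtain ⟨ψ, hψ⟩ := hφ.exists_isAuxiliaryAngle
    exact ⟨hdn, φ, ψ, hφ, hψ, hψ.dnTwo_eq_cos h₀ h₁ hφ hκ h⟩

/-! ### Fundamental periods -/

lemma periodic_comp_const_mul_iff {𝕜 X : Type*} [DivisionRing 𝕜] {f : 𝕜 → X} {a : 𝕜} (ha : a ≠ 0)
    (w : 𝕜) : Function.Periodic (fun x ↦ f (a * x)) w ↔ Function.Periodic f (a * w) := by
  refine ⟨fun h ↦ ?_, fun h ↦ ?_⟩
  · simpa [ha] using h.const_inv_mul a
  · simpa [ha] using h.const_mul a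

lemma linearIndependent_two_mul {K K' : ℝ} (hK : K ≠ 0) (hK' : K' ≠ 0) :
    LinearIndependent ℝ ![2 * (K : ℂ), 2 * Complex.I * (K' : ℂ)] := by
  rw [LinearIndependent.pair_iff]
  intro s t hst
  have hre : s = 0 ∨ K = 0 := by simpa using congrArg Complex.re hst
  have him : t = 0 ∨ K' = 0 := by simpa using congrArg Complex.im hst
  exact ⟨hre.resolve_right hK, him.resolve_right hK'⟩

lemma isFundamentalPeriods_dnTwo {lam : ℝ} (h₀ : 0 < lam) (h₁ : lam < 1) :
    IsFundamentalPeriods (dnTwo lam)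
      (2 * (√(2 / (1 + lam)) * ellipticK ((1 - lam) / (1 + lam)) : ℝ))
      (2 * Complex.I * (√(2 / (1 + lam)) * ellipticK (2 * lam / (1 + lam)) : ℝ)) := by
  have hscale : √(2 / (1 + lam)) = (√((1 + lam) / 2))⁻¹ := by rw [← Real.sqrt_inv, inv_div]
  have ha : √((1 + lam) / 2) ≠ 0 := (Real.sqrt_pos.mpr (by linarith)).ne'
  have haC : (√((1 + lam) / 2) : ℂ) ≠ 0 := Complex.ofReal_ne_zero.mpr ha
  have hc : (1 - (lam : ℂ)) / 2 ≠ 0 := by exact_mod_cast (by linarith : (1 - lam) / 2 ≠ 0)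
  have hm := modulus_lt_one h₀
  have hm' := sub_lt_self 1 (modulus_pos h₀ h₁)
  rw [← one_sub_modulus h₀, hscale]
  refine ⟨linearIndependent_two_mul (mul_ne_zero (inv_ne_zero ha) (ellipticK_pos hm).ne')
    (mul_ne_zero (inv_ne_zero ha) (ellipticK_pos hm').ne'), fun w ↦ ?_⟩
  refine (periodic_comp_const_mul_iff haC w).trans
    ((periodic_snForm_iff (modulus_pos h₀ h₁) hm hc _).trans ?_)
  refine exists₂_congr fun n k ↦ ?_
  rw [← eq_inv_mul_iff_mul_eq₀ haC]
  push_cast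
  ring_nf

lemma le_of_eq_intCast_mul {R : Type*} [Ring R] [LinearOrder R] [IsStrictOrderedRing R] {x y : R}
    (hx : 0 < x) (hy : 0 < y) {n : ℤ} (h : x = n * y) : y ≤ x := by
  have hn : (0 : R) < n := pos_of_mul_pos_left (h ▸ hx) hy.le
  rw [h]
  exact le_mul_of_one_le_left hy.le (mod_cast Int.cast_pos.mp hn)

lemma IsFundamentalPeriods.half_le {d : ℂ → ℂ} {K₀ K₀' K K' : ℝ}
    (h : IsFundamentalPeriods d (2 * K) (2 * Complex.I * K'))
    (h₀ : IsFundamentalPeriods d (2 * K₀) (2 * Complex.I * K₀'))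
    (hK₀ : 0 < K₀) (hK₀' : 0 < K₀') (hK : 0 < K) (hK' : 0 < K') : K ≤ K₀ ∧ K' ≤ K₀' := by
  obtain ⟨n, k, hnk⟩ := (h.2 (2 * K₀)).mp ((h₀.2 _).mpr ⟨1, 0, by simp⟩)
  obtain ⟨n', k', hnk'⟩ := (h.2 (2 * Complex.I * K₀')).mp ((h₀.2 _).mpr ⟨0, 1, by simp⟩)
  have hre : 2 * K₀ = n * (2 * K) := by simpa using congrArg Complex.re hnk
  have him : 2 * K₀' = k' * (2 * K') := by simpa using congrArg Complex.im hnk'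
  exact ⟨le_of_eq_intCast_mul hK₀ hK (n := n) (by linarith),
    le_of_eq_intCast_mul hK₀' hK' (n := k') (by linarith)⟩

lemma IsFundamentalPeriods.half_eq_iff {d : ℂ → ℂ} {K₀ K₀' K K' : ℝ}
    (h₀ : IsFundamentalPeriods d (2 * K₀) (2 * Complex.I * K₀'))
    (hK₀ : 0 < K₀) (hK₀' : 0 < K₀') (hK : 0 < K) (hK' : 0 < K') :
    IsFundamentalPeriods d (2 * K) (2 * Complex.I * K') ↔ K = K₀ ∧ K' = K₀' := by
  refine ⟨fun h ↦ ?_, ?_⟩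
  · obtain ⟨hle, hle'⟩ := h.half_le h₀ hK₀ hK₀' hK hK'
    obtain ⟨hge, hge'⟩ := h₀.half_le h hK hK' hK₀ hK₀'
    exact ⟨le_antisymm hle hge, le_antisymm hle' hge'⟩
  · rintro ⟨rfl, rfl⟩
    exact h₀

end SignatureFour

end

theorem mainTheorem6 (κ lam : ℝ) (hκ₀ : 0 < κ) (hκ₁ : κ < 1) (hlam : lam = √(1 - κ ^ 2)) :
    (∃! d : ℂ → ℂ, SignatureFour.IsDn κ d) ∧
    ∀ d : ℂ → ℂ, SignatureFour.IsDn κ d →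
      ∀ K K' : ℝ, 0 < K → 0 < K' →
        (SignatureFour.IsFundamentalPeriods d (2 * (K : ℂ)) (2 * Complex.I * (K' : ℂ)) ↔
          K = √(2 / (1 + lam)) * SignatureFour.ellipticK ((1 - lam) / (1 + lam)) ∧
          K' = √(2 / (1 + lam)) * SignatureFour.ellipticK (2 * lam / (1 + lam))) := by
  have hκ : 0 < 1 - κ ^ 2 := by nlinarith
  have h₀ : 0 < lam := hlam ▸ Real.sqrt_pos.mpr hκ
  have hsq : lam ^ 2 = 1 - κ ^ 2 := by rw [hlam, Real.sq_sqrt hκ.le]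
  have h₁ : lam < 1 := by nlinarith
  have hdn := SignatureFour.isDn_iff h₀ h₁ hκ₀.le hsq
  have hm := SignatureFour.modulus_lt_one h₀
  have hm' : 2 * lam / (1 + lam) < 1 :=
    SignatureFour.one_sub_modulus h₀ ▸ sub_lt_self 1 (SignatureFour.modulus_pos h₀ h₁)
  have hs : 0 < √(2 / (1 + lam)) := by positivity
  refine ⟨⟨_, (hdn _).mpr rfl, fun d ↦ (hdn d).mp⟩, fun d hd K K' hK hK' ↦ ?_⟩
  rw [(hdn d).mp hd]
  exact (SignatureFour.isFundamentalPeriods_dnTwo h₀ h₁).half_eq_iff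
    (mul_pos hs (SignatureFour.ellipticK_pos hm)) (mul_pos hs (SignatureFour.ellipticK_pos hm'))
    hK hK'
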